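/- Let $\mathcal G=(\mathcal V,\mathcal E)$ be a directed multigraph without self-loops, with finite link set $\mathcal E$; link $e$ goes from its tail $\tau(e)$ to its head $\sigma(e)$. Let $R\in\mathbb R^{\mathcal E\times\mathcal E}$ be a routing matrix: $R_{ij}\ge 0$, $\sum_j R_{ij}\le 1$ for all $i$, and $R_{ij}>0$ only if $\sigma(i)=\tau(j)$. Assume that $R$ is out-flow connected: for every link $i$ there are a link $j$ with $\sum_k R_{jk}<1$ and an integer $\ell\ge 0$ with $(R^\ell)_{ij}>0$. (Then $I-R^T$ is invertible.) For $i\in\mathcal E$ let $f_i:\mathbb R_+^{\mathcal E}\to\mathbb R_+$ be Lipschitz continuous with $f_i(x)=0$ if and only if $x_i=0$, and assume that $f_i$ is bounded, with capacity $c_i=\sup_{x\ge 0}f_i(x)$ (so $c_i>0$). Put $C=\mathrm{diag}(c)$, $\bar c=(1/c_i)_{i\in\mathcal E}$, $\tilde f_i(x)=f_i(x)/c_i$, $\|z\|=\sum_i|z_i|$, $\|z\|_{\bar c}=\sum_i|z_i|/c_i$. For an inflow $\lambda:[0,\infty)\to\mathbb R_+^{\mathcal E}$ (locally integrable), let $a(t)=(I-R^T)^{-1}\lambda(t)$,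 and consider the dynamics $$\dot x=\lambda(t)-(I-R^T)\,C\,\tilde f(x),\qquad x(t)\in\mathbb R_+^{\mathcal E},$$ whose solutions are the continuous functions satisfying the corresponding integral equation. If $$\operatorname*{ess\,sup}_{t\ge 0}\sum_{i\in\mathcal E}\frac{a_i(t)}{c_i}<\liminf_{\|x\|\to\infty,\ x\ge0}\ \sum_{i\in\mathcal E}\tilde f_i(x),$$ then the network is input-to-state stable in the norm $\|(I-R^T)^{-1}\cdot\|_{\bar c}$, in the following sense. For every real number $U<\liminf_{\|x\|\to\infty,\,x\ge0}\sum_i\tilde f_i(x)$ there are functions $\beta\in\mathcal{KL}$ and $\mu\in\mathcal K_\infty$ such that for every inflow $\lambda$ with $\operatorname{ess\,sup}_{t\ge0}\sum_i a_i(t)/c_i\le U$, every $T\ge0$ and every solution $x$ on $[0,T]$ (in particular every solution on $[0,\infty)$), $$\|(I-R^T)^{-1}x(t)\|_{\bar c}\le\beta\big(\|(I-R^T)^{-1}x(0)\|_{\bar c},\,t\big)+\mu\Big(\operatorname*{ess\,sup}_{s\ge0}\|(I-R^T)^{-1}\lambda(s)\|_{\bar c}\Big)\qquad\text{for all }t\in[0,T].$$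 Here $\mu:\mathbb R_+\to\mathbb R_+$ is of class $\mathcal K_\infty$ if it is continuous and strictly increasing, $\mu(0)=0$ and $\mu(s)\to\infty$ as $s\to\infty$; $\beta:\mathbb R_+\times\mathbb R_+\to\mathbb R_+$ is of class $\mathcal{KL}$ if, for each fixed $t$, $\beta(\cdot,t)$ is continuous and strictly increasing with $\beta(0,t)=0$, and, for each fixed $s$, $\beta(s,\cdot)$ is non-increasing with $\beta(s,t)\to0$ as $t\to\infty$. -/

import Mathlib

open MeasureTheory Filter Set Matrix

/-- A dynamical flow network: a directed multigraph without self-loops, with node set `V` and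
(finite) link set `E`, where the link `e` goes from `tail e` to `head e`, together with a routing
matrix `R`: `R i j` is the fraction of the outflow of link `i` that proceeds to link `j`. -/
structure FlowNetwork (V E : Type*) [Fintype E] where
  tail : E → V
  head : E → V
  no_self_loop : ∀ e, tail e ≠ head e
  R : Matrix E E ℝ
  R_nonneg : ∀ i j, 0 ≤ R i j
  R_row_sum_le_one : ∀ i, ∑ j, R i j ≤ 1
  R_topology : ∀ i j, 0 < R i j → head i = tail j

namespace FlowNetwork

/-- From every link there is a path (possibly of length zero) to a link from which a positive
fraction of the mass leaves the network. -/
def OutflowConnected {V E : Type*} [Fintype E] [DecidableEq E] (N : FlowNetwork V E) : Prop :=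
  ∀ i, ∃ j, (∃ l : ℕ, 0 < (N.R ^ l) i j) ∧ ∑ k, N.R j k < 1

/-- The linear transformation `z ↦ (I - Rᵀ)⁻¹ z`. -/
noncomputable def transform {V E : Type*} [Fintype E] [DecidableEq E] (N : FlowNetwork V E)
    (z : E → ℝ) : E → ℝ :=
  (1 - N.Rᵀ)⁻¹ *ᵥ z

end FlowNetwork

/-- The state space: vectors of non-negative masses. -/
def stateSpace (E : Type*) : Set (E → ℝ) := {x | ∀ i, 0 ≤ x i}

/-- The vector of flow functions `f`: on the state space, every component is Lipschitz continuous
and non-negative, and it vanishes exactly when the link is empty. Only the values of `f` on the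
state space matter. -/
structure IsFlowFunction {E : Type*} [Fintype E] (f : (E → ℝ) → E → ℝ) : Prop where
  lipschitz : ∀ i, ∃ K, LipschitzOnWith K (fun x => f x i) (stateSpace E)
  nonneg : ∀ x ∈ stateSpace E, ∀ i, 0 ≤ f x i
  eq_zero_iff : ∀ x ∈ stateSpace E, ∀ i, f x i = 0 ↔ x i = 0

/-- The capacity of link `i` is `c i`, the (finite) supremum of its flow function. -/
def IsCapacity {E : Type*} (f : (E → ℝ) → E → ℝ) (c : E → ℝ) : Prop :=
  ∀ i, IsLUB ((fun x => f x i) '' stateSpace E) (c i)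

/-- The flow functions normalized by the capacities. -/
noncomputable def normalizedFlow {E : Type*} (f : (E → ℝ) → E → ℝ) (c : E → ℝ)
    (x : E → ℝ) (i : E) : ℝ :=
  f x i / c i

/-- An exogenous inflow: non-negative and locally integrable on `[0, ∞)`. -/
structure IsInflow {E : Type*} (lam : ℝ → E → ℝ) : Prop where
  nonneg : ∀ t, 0 ≤ t → ∀ i, 0 ≤ lam t i
  integrable : ∀ T, 0 ≤ T → ∀ i, IntervalIntegrable (fun t => lam t i) volume 0 T

/-- `x` is a (Carathéodory) solution on `[0, T]`, with values in the state space, of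
`x' = lam(t) - (I - Rᵀ) C g(x)`, where `C = diag c`. -/
structure FlowNetwork.IsSolution {V E : Type*} [Fintype E] [DecidableEq E] (N : FlowNetwork V E)
    (c : E → ℝ) (g : (E → ℝ) → E → ℝ) (lam : ℝ → E → ℝ) (T : ℝ) (x : ℝ → E → ℝ) : Prop where
  continuousOn : ContinuousOn x (Icc 0 T)
  mem : ∀ t ∈ Icc 0 T, x t ∈ stateSpace E
  integral_eq : ∀ t ∈ Icc 0 T, ∀ i, x t i = x 0 i +
    ∫ s in (0 : ℝ)..t, (lam s i - (((1 - N.Rᵀ) * Matrix.diagonal c) *ᵥ g (x s)) i)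

/-- The `w`-weighted `ℓ¹` norm. -/
def weightedNorm {E : Type*} [Fintype E] (w : E → ℝ) (z : E → ℝ) : ℝ :=
  ∑ i, w i * |z i|

/-- `‖x‖ → ∞` (in the `ℓ¹` norm) within the state space. -/
def toInfinity (E : Type*) [Fintype E] : Filter (E → ℝ) :=
  comap (fun x => ∑ i, |x i|) atTop ⊓ 𝓟 (stateSpace E)

/-- The essential supremum over `t ≥ 0`, as an extended real number. -/
noncomputable def essSupTime (h : ℝ → ℝ) : EReal :=
  essSup (fun t => (h t : EReal)) (volume.restrict (Ici 0))

/-- Functions of class `K∞` (on `[0, ∞)`). -/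
structure IsKInfty (mu : ℝ → ℝ) : Prop where
  zero : mu 0 = 0
  strictMonoOn : StrictMonoOn mu (Ici 0)
  continuousOn : ContinuousOn mu (Ici 0)
  tendsto : Tendsto mu atTop atTop

/-- Functions of class `KL` (on `[0, ∞) × [0, ∞)`). -/
structure IsKL (beta : ℝ → ℝ → ℝ) : Prop where
  zero : ∀ t, 0 ≤ t → beta 0 t = 0
  strictMonoOn : ∀ t, 0 ≤ t → StrictMonoOn (fun s => beta s t) (Ici 0)
  continuousOn : ∀ t, 0 ≤ t → ContinuousOn (fun s => beta s t) (Ici 0)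
  antitoneOn : ∀ s, 0 ≤ s → AntitoneOn (fun t => beta s t) (Ici 0)
  tendsto : ∀ s, 0 ≤ s → Tendsto (fun t => beta s t) atTop (nhds 0)

/-! The proof is a Lyapunov argument with the linear function `W x = p ⬝ᵥ x`, where `p` is
`potential`. Since `(I - Rᵀ)⁻¹` has non-negative entries (`inv_nonneg`), `W` is the transformed norm
on the orthant. Moreover `pᵀ (I - Rᵀ) C` is the all-ones row, so along solutions `W' = ∑ aᵢ/cᵢ -
Φ(x)` with `Φ = ∑ f̃ᵢ` (`potential_balance`), and the problem becomes scalar.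

`Φ` vanishes only at `0`, has a positive minimum on each non-empty compact slice `v ≤ W ≤ M`, `v >
0`, and is at least some `L > U` where `W ≥ M`. Hence `Φ ≥ g(W)` for a decay rate `g`. Let `d ≤ U`
be the essential supremum of the input and fix `κ < 1` with `U < κ L`. Then `d ≤ κ Φ` while `W >
μ(d)`: for `W ≤ M` by the choice of `μ`, for `W ≥ M` because `d ≤ U < κ L`. So `W' ≤ -(1 - κ) g(W)`
there, and `le_or_decay` gives `W ≤ μ(d)` or `W ≤ β(W(0), t)`. -/

namespace FlowNetwork

variable {V E : Type*} [Fintype E] [DecidableEq E]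

/-! ### Substochastic routing matrices and positivity of the inverse. -/

lemma pow_R_nonneg (N : FlowNetwork V E) (n : ℕ) (i j : E) : 0 ≤ (N.R ^ n) i j := by
  induction n generalizing i j with
  | zero => rw [pow_zero, Matrix.one_apply]; split_ifs <;> norm_num
  | succ n ih =>
    rw [pow_succ, Matrix.mul_apply]
    exact Finset.sum_nonneg fun k _ => mul_nonneg (ih i k) (N.R_nonneg k j)

lemma sum_pow_R_succ (N : FlowNetwork V E) (n : ℕ) (i : E) :
    ∑ j, (N.R ^ (n + 1)) i j = ∑ k, (N.R ^ n) i k * ∑ j, N.R k j := by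
  simp_rw [pow_succ, Matrix.mul_apply, Finset.mul_sum]
  exact Finset.sum_comm

lemma sum_pow_R_le_one (N : FlowNetwork V E) (n : ℕ) (i : E) : ∑ j, (N.R ^ n) i j ≤ 1 := by
  induction n with
  | zero => simp [Matrix.one_apply]
  | succ n ih =>
    rw [sum_pow_R_succ]
    refine le_trans (Finset.sum_le_sum fun k _ => ?_) ih
    exact mul_le_of_le_one_right (N.pow_R_nonneg n i k) (N.R_row_sum_le_one k)

/-- A positive share of the mass of `i` reaches a leaking link after `l` steps and loses a part in
the next one. -/
lemma OutflowConnected.exists_sum_pow_lt_one {N : FlowNetwork V E} (hN : N.OutflowConnected)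
    (i : E) : ∃ n, ∑ j, (N.R ^ n) i j < 1 := by
  obtain ⟨j, ⟨l, hl⟩, hj⟩ := hN i
  refine ⟨l + 1, ?_⟩
  rw [sum_pow_R_succ]
  refine lt_of_lt_of_le (Finset.sum_lt_sum (fun k _ => ?_) ⟨j, Finset.mem_univ j, ?_⟩)
    (N.sum_pow_R_le_one l i)
  · exact mul_le_of_le_one_right (N.pow_R_nonneg l i k) (N.R_row_sum_le_one k)
  · exact mul_lt_of_lt_one_right hl hj

lemma pow_R_mulVec_le (N : FlowNetwork V E) {x : E → ℝ} (hx : ∀ i, (N.R *ᵥ x) i ≤ x i) (n : ℕ)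
    (i : E) : ((N.R ^ n) *ᵥ x) i ≤ x i := by
  induction n generalizing i with
  | zero => simp
  | succ n ih =>
    rw [pow_succ', ← Matrix.mulVec_mulVec]
    refine le_trans ?_ (hx i)
    exact Finset.sum_le_sum fun k _ => mul_le_mul_of_nonneg_left (ih k) (N.R_nonneg i k)

/-- Minimum principle: superharmonic vectors of an out-flow connected network are non-negative. -/
lemma OutflowConnected.nonneg_of_mulVec_le {N : FlowNetwork V E} (hN : N.OutflowConnected)
    {x : E → ℝ} (hx : ∀ i, (N.R *ᵥ x) i ≤ x i) (i : E) : 0 ≤ x i := by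
  have : Nonempty E := ⟨i⟩
  obtain ⟨k, hk⟩ := Finite.exists_min x
  refine le_trans ?_ (hk i)
  by_contra! hneg
  obtain ⟨n, hn⟩ := hN.exists_sum_pow_lt_one k
  have h1 : (∑ j, (N.R ^ n) k j) * x k ≤ ((N.R ^ n) *ᵥ x) k := by
    rw [Finset.sum_mul]
    exact Finset.sum_le_sum fun j _ => mul_le_mul_of_nonneg_left (hk j) (N.pow_R_nonneg n k j)
  have h2 := h1.trans (N.pow_R_mulVec_le hx n k)
  -- The row sum is below `1` and `x k < 0`, so `(∑ j, (R ^ n) k j) * x k > x k`, against `h2`.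
  nlinarith

lemma OutflowConnected.isUnit_one_sub {N : FlowNetwork V E} (hN : N.OutflowConnected) :
    IsUnit (1 - N.R) := by
  rw [← Matrix.mulVec_injective_iff_isUnit]
  intro x y hxy
  have key : ∀ u v : E → ℝ, (1 - N.R) *ᵥ u = (1 - N.R) *ᵥ v → ∀ i, v i ≤ u i := by
    intro u v huv i
    have h : N.R *ᵥ (u - v) = u - v := by
      have h' : (1 - N.R) *ᵥ (u - v) = 0 := by rw [Matrix.mulVec_sub, huv, sub_self]
      rw [Matrix.sub_mulVec, Matrix.one_mulVec, sub_eq_zero] at h'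
      exact h'.symm
    have := hN.nonneg_of_mulVec_le (x := u - v) (fun j => by rw [h]) i
    simpa using this
  exact funext fun i => le_antisymm (key y x hxy.symm i) (key x y hxy i)

lemma OutflowConnected.isUnit_one_sub_transpose {N : FlowNetwork V E} (hN : N.OutflowConnected) :
    IsUnit (1 - N.Rᵀ) := by
  have := (Matrix.isUnit_transpose (A := 1 - N.R)).2 hN.isUnit_one_sub
  simpa using this

/-- Each column `y` of `(I - R)⁻¹` satisfies `y - R y ≥ 0`, being mapped to a unit vector, so the
minimum principle applies. -/
lemma OutflowConnected.inv_nonneg {N : FlowNetwork V E} (hN : N.OutflowConnected) (i j : E) :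
    0 ≤ (1 - N.Rᵀ)⁻¹ i j := by
  have ht : (1 - N.Rᵀ)⁻¹ = ((1 - N.R)⁻¹)ᵀ := by
    rw [Matrix.transpose_nonsing_inv, Matrix.transpose_sub, Matrix.transpose_one]
  have hmul : (1 - N.R) * (1 - N.R)⁻¹ = 1 :=
    Matrix.mul_nonsing_inv _ ((Matrix.isUnit_iff_isUnit_det _).1 hN.isUnit_one_sub)
  rw [ht, Matrix.transpose_apply]
  refine hN.nonneg_of_mulVec_le (x := fun k => (1 - N.R)⁻¹ k i) (fun k => ?_) j
  have h := congrFun (congrFun hmul k) i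
  rw [Matrix.sub_mul, Matrix.one_mul, Matrix.sub_apply, Matrix.one_apply] at h
  have h0 : (0 : ℝ) ≤ if k = i then 1 else 0 := by split_ifs <;> norm_num
  have h1 : (N.R *ᵥ fun k => (1 - N.R)⁻¹ k i) k = (N.R * (1 - N.R)⁻¹) k i := rfl
  linarith

lemma OutflowConnected.transform_nonneg {N : FlowNetwork V E} (hN : N.OutflowConnected)
    {z : E → ℝ} (hz : ∀ i, 0 ≤ z i) (i : E) : 0 ≤ N.transform z i :=
  Finset.sum_nonneg fun j _ => mul_nonneg (hN.inv_nonneg i j) (hz j)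

lemma OutflowConnected.le_transform {N : FlowNetwork V E} (hN : N.OutflowConnected)
    {z : E → ℝ} (hz : ∀ i, 0 ≤ z i) (i : E) : z i ≤ N.transform z i := by
  have h : (1 - N.Rᵀ) *ᵥ N.transform z = z := by
    rw [transform, Matrix.mulVec_mulVec, Matrix.mul_nonsing_inv _
      ((Matrix.isUnit_iff_isUnit_det _).1 hN.isUnit_one_sub_transpose), Matrix.one_mulVec]
  have h1 := congrFun h i
  rw [Matrix.sub_mulVec, Matrix.one_mulVec, Pi.sub_apply] at h1
  have h2 : 0 ≤ (N.Rᵀ *ᵥ N.transform z) i :=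
    Finset.sum_nonneg fun j _ => mul_nonneg (N.R_nonneg j i) (hN.transform_nonneg hz j)
  linarith

/-! ### The linear Lyapunov function. -/

/-- The weights `p = (I - R)⁻¹ c̄`, so that `‖(I - Rᵀ)⁻¹ z‖_c̄ = ⟨p, z⟩` for `z ≥ 0`. -/
noncomputable def potential (N : FlowNetwork V E) (c : E → ℝ) : E → ℝ :=
  (fun i => 1 / c i) ᵥ* (1 - N.Rᵀ)⁻¹

lemma potential_dotProduct (N : FlowNetwork V E) (c z : E → ℝ) :
    N.potential c ⬝ᵥ z = ∑ i, N.transform z i / c i := by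
  rw [potential, ← Matrix.dotProduct_mulVec]
  exact Finset.sum_congr rfl fun i _ => by
    change 1 / c i * N.transform z i = _
    ring

lemma OutflowConnected.weightedNorm_transform {N : FlowNetwork V E} (hN : N.OutflowConnected)
    (c : E → ℝ) {z : E → ℝ} (hz : ∀ i, 0 ≤ z i) :
    weightedNorm (fun i => 1 / c i) (N.transform z) = N.potential c ⬝ᵥ z := by
  rw [potential_dotProduct]
  exact Finset.sum_congr rfl fun i _ => by rw [abs_of_nonneg (hN.transform_nonneg hz i)]; ring

lemma OutflowConnected.potential_nonneg {N : FlowNetwork V E} (hN : N.OutflowConnected)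
    {c : E → ℝ} (hc : ∀ i, 0 < c i) (j : E) : 0 ≤ N.potential c j :=
  Finset.sum_nonneg fun i _ => mul_nonneg (one_div_pos.2 (hc i)).le (hN.inv_nonneg i j)

/-- This coercivity makes the sublevel sets of the potential in the orthant compact. -/
lemma OutflowConnected.div_le_potential_dotProduct {N : FlowNetwork V E}
    (hN : N.OutflowConnected) {c : E → ℝ} (hc : ∀ i, 0 < c i) {z : E → ℝ} (hz : ∀ i, 0 ≤ z i)
    (i : E) : z i / c i ≤ N.potential c ⬝ᵥ z := by
  rw [potential_dotProduct]
  refine le_trans (div_le_div_of_nonneg_right (hN.le_transform hz i) (hc i).le) ?_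
  exact Finset.single_le_sum (f := fun i => N.transform z i / c i)
    (fun j _ => div_nonneg (hN.transform_nonneg hz j) (hc j).le) (Finset.mem_univ i)

lemma OutflowConnected.potential_dotProduct_outflow {N : FlowNetwork V E}
    (hN : N.OutflowConnected) {c : E → ℝ} (hc : ∀ i, 0 < c i) (g : E → ℝ) :
    N.potential c ⬝ᵥ (((1 - N.Rᵀ) * Matrix.diagonal c) *ᵥ g) = ∑ i, g i := by
  rw [potential, ← Matrix.dotProduct_mulVec, Matrix.mulVec_mulVec, ← Matrix.mul_assoc,
    Matrix.nonsing_inv_mul _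
      ((Matrix.isUnit_iff_isUnit_det _).1 hN.isUnit_one_sub_transpose), Matrix.one_mul]
  refine Finset.sum_congr rfl fun i _ => ?_
  rw [Matrix.mulVec_diagonal]
  change 1 / c i * (c i * g i) = g i
  rw [one_div, inv_mul_cancel_left₀ (hc i).ne']

end FlowNetwork

/-! ### Elementary properties of flow functions. -/

lemma IsCapacity.pos {E : Type*} [Fintype E] {f : (E → ℝ) → E → ℝ} {c : E → ℝ}
    (hc : IsCapacity f c) (hf : IsFlowFunction f) (i : E) : 0 < c i := by
  have h1 : (1 : E → ℝ) ∈ stateSpace E := fun _ => zero_le_one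
  have h2 : f 1 i ≠ 0 := fun h => one_ne_zero ((hf.eq_zero_iff 1 h1 i).1 h)
  exact lt_of_lt_of_le (lt_of_le_of_ne (hf.nonneg 1 h1 i) h2.symm) ((hc i).1 ⟨1, h1, rfl⟩)

lemma IsFlowFunction.continuousOn_sum {E : Type*} [Fintype E] {f : (E → ℝ) → E → ℝ}
    (hf : IsFlowFunction f) (c : E → ℝ) :
    ContinuousOn (fun x => ∑ i, normalizedFlow f c x i) (stateSpace E) := by
  refine continuousOn_finsetSum _ fun i _ => ?_
  obtain ⟨K, hK⟩ := hf.lipschitz i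
  exact hK.continuousOn.div_const _

lemma IsFlowFunction.sum_nonneg {E : Type*} [Fintype E] {f : (E → ℝ) → E → ℝ}
    (hf : IsFlowFunction f) {c : E → ℝ} (hc : ∀ i, 0 < c i) {x : E → ℝ} (hx : x ∈ stateSpace E) :
    0 ≤ ∑ i, normalizedFlow f c x i :=
  Finset.sum_nonneg fun i _ => div_nonneg (hf.nonneg x hx i) (hc i).le

lemma IsFlowFunction.sum_pos {E : Type*} [Fintype E] {f : (E → ℝ) → E → ℝ}
    (hf : IsFlowFunction f) {c : E → ℝ} (hc : ∀ i, 0 < c i) {x : E → ℝ} (hx : x ∈ stateSpace E)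
    (hx0 : x ≠ 0) : 0 < ∑ i, normalizedFlow f c x i := by
  obtain ⟨i, hi⟩ := Function.ne_iff.1 hx0
  refine Finset.sum_pos' (fun j _ => div_nonneg (hf.nonneg x hx j) (hc j).le)
    ⟨i, Finset.mem_univ i, div_pos ?_ (hc i)⟩
  exact lt_of_le_of_ne (hf.nonneg x hx i) fun h => hi ((hf.eq_zero_iff x hx i).1 h.symm)

/-! ### Decay rates and comparison functions. -/

lemma exists_continuous_inverse {h : ℝ → ℝ} (hc : Continuous h) (hm : StrictMono h)
    (htop : Tendsto h atTop atTop) (hbot : Tendsto h atBot atBot) :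
    ∃ k : ℝ → ℝ, Continuous k ∧ StrictMono k ∧ Tendsto k atTop atTop ∧
      (∀ s, h (k s) = s) ∧ ∀ b, k (h b) = b := by
  let e := StrictMono.orderIsoOfSurjective h hm (hc.surjective htop hbot)
  exact ⟨e.symm, e.symm.continuous, e.symm.strictMono, e.symm.tendsto_atTop,
    fun s => e.apply_symm_apply s, fun b => e.symm_apply_apply b⟩

/-- A continuous monotone function on the line that vanishes on `(-∞, 0]` and is positive on
`(0, ∞)`; it serves as a decay rate. -/
structure IsDecayRate (g : ℝ → ℝ) : Prop where
  continuous : Continuous g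
  monotone : Monotone g
  zero : ∀ v ≤ 0, g v = 0
  pos : ∀ v, 0 < v → 0 < g v

namespace IsDecayRate

variable {g : ℝ → ℝ}

lemma nonneg (hg : IsDecayRate g) (v : ℝ) : 0 ≤ g v := by
  rcases le_or_gt v 0 with h | h
  · exact (hg.zero v h).ge
  · exact (hg.pos v h).le

lemma const_mul (hg : IsDecayRate g) {k : ℝ} (hk : 0 < k) : IsDecayRate fun v => k * g v where
  continuous := continuous_const.mul hg.continuous
  monotone := hg.monotone.const_mul hk.le
  zero v hv := by rw [hg.zero v hv, mul_zero]
  pos v hv := mul_pos hk (hg.pos v hv)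

/-- The solutions `b` of `b + t * g b = s` form a function of class `KL`. -/
lemma exists_isKL (hg : IsDecayRate g) :
    ∃ beta : ℝ → ℝ → ℝ, IsKL beta ∧
      ∀ t, 0 ≤ t → ∀ b s, b + t * g b ≤ s → b ≤ beta s t := by
  have hinv : ∀ t : ℝ, ∃ k : ℝ → ℝ, 0 ≤ t → Continuous k ∧ StrictMono k ∧
      (∀ s, k s + t * g (k s) = s) ∧ ∀ b, k (b + t * g b) = b := by
    intro t
    by_cases ht : 0 ≤ t
    · obtain ⟨k, h1, h2, -, h3, h4⟩ := exists_continuous_inverse (h := fun b => b + t * g b)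
        (continuous_id.add (continuous_const.mul hg.continuous))
        (strictMono_id.add_monotone (hg.monotone.const_mul ht))
        (tendsto_atTop_mono (fun b => le_add_of_nonneg_right (mul_nonneg ht (hg.nonneg b)))
          tendsto_id)
        (tendsto_id.congr' (by
          filter_upwards [eventually_le_atBot 0] with b hb
          simp [hg.zero b hb]))
      exact ⟨k, fun _ => ⟨h1, h2, h3, h4⟩⟩
    · exact ⟨id, fun h => absurd h ht⟩
  choose k hk using hinv
  have hzero : ∀ t, 0 ≤ t → k t 0 = 0 := fun t ht => by
    have := (hk t ht).2.2.2 0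
    rwa [hg.zero 0 le_rfl, mul_zero, add_zero] at this
  have hnonneg : ∀ t, 0 ≤ t → ∀ s, 0 ≤ s → 0 ≤ k t s := fun t ht s hs => by
    rw [← hzero t ht]; exact (hk t ht).2.1.monotone hs
  have hle : ∀ t, 0 ≤ t → ∀ b s, b + t * g b ≤ s → b ≤ k t s := fun t ht b s hb => by
    rw [← (hk t ht).2.2.2 b]; exact (hk t ht).2.1.monotone hb
  refine ⟨fun s t => k t s, ⟨hzero, fun t ht => (hk t ht).2.1.strictMonoOn _,
    fun t ht => (hk t ht).1.continuousOn, ?_, ?_⟩, hle⟩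
  · intro s hs t₁ ht₁ t₂ ht₂ h12
    refine hle t₁ ht₁ _ s (le_trans ?_ ((hk t₂ ht₂).2.2.1 s).le)
    exact add_le_add_right (mul_le_mul_of_nonneg_right h12 (hg.nonneg _)) _
  · intro s hs
    rw [Metric.tendsto_atTop]
    intro ε hε
    have hgε := hg.pos ε hε
    refine ⟨s / g ε, fun t ht => ?_⟩
    have ht0 : 0 ≤ t := le_trans (div_nonneg hs hgε.le) ht
    rw [Real.dist_eq, sub_zero, abs_of_nonneg (hnonneg t ht0 s hs)]
    by_contra! hcon
    -- If `k t s ≥ ε`, then `s = k t s + t * g (k t s) ≥ ε + t * g ε ≥ ε + s`.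
    have h1 := (hk t ht0).2.2.1 s
    have h2 : s ≤ t * g ε := (div_le_iff₀ hgε).1 ht
    have h3 : t * g ε ≤ t * g (k t s) := mul_le_mul_of_nonneg_left (hg.monotone hcon) ht0
    linarith

/-- A gain of class `K∞` above which, up to the level `M`, the rate `g` exceeds the input. -/
lemma exists_isKInfty (hg : IsDecayRate g) {M : ℝ} (hM : 0 < M) :
    ∃ mu : ℝ → ℝ, IsKInfty mu ∧ ∀ d v, 0 ≤ d → mu d < v → v ≤ M → d ≤ g v := by
  -- `g` may be bounded and locally constant; the factor `v / M` makes `q` strictly increasing and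
  -- unbounded on `[0, ∞)`, yet `q ≤ g` on `[0, M]`. The term `min v 0` extends it to a
  -- homeomorphism of the line.
  let q : ℝ → ℝ := fun v => g v * (v / M) + min v 0
  have hqneg : ∀ v ≤ 0, q v = v := fun v hv => by simp [q, hg.zero v hv, hv]
  have hqpos : ∀ v, 0 ≤ v → q v = g v * (v / M) := fun v hv => by simp [q, hv]
  have hqm : StrictMono q := by
    intro u v huv
    rcases le_or_gt v 0 with hv | hv
    · rwa [hqneg u (huv.le.trans hv), hqneg v hv]
    · rw [hqpos v hv.le]
      have hv' : 0 < g v * (v / M) := mul_pos (hg.pos v hv) (div_pos hv hM)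
      rcases le_or_gt u 0 with hu | hu
      · rw [hqneg u hu]; exact hu.trans_lt hv'
      · rw [hqpos u hu.le]
        exact mul_lt_mul_of_le_of_lt_of_nonneg_of_pos (hg.monotone huv.le)
          (div_lt_div_of_pos_right huv hM) (div_pos hu hM).le (hg.pos v hv)
  have hqtop : Tendsto q atTop atTop := by
    refine tendsto_atTop_mono' atTop (f₁ := fun v => g 1 * (v / M)) ?_
      ((tendsto_id.atTop_div_const hM).const_mul_atTop (hg.pos 1 one_pos))
    filter_upwards [eventually_ge_atTop 1] with v hv
    rw [hqpos v (zero_le_one.trans hv)]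
    exact mul_le_mul_of_nonneg_right (hg.monotone hv) (div_nonneg (zero_le_one.trans hv) hM.le)
  have hqc : Continuous q :=
    (hg.continuous.mul (continuous_id.div_const M)).add (continuous_id.min continuous_const)
  obtain ⟨k, hkc, hkm, hkt, hqk, hkq⟩ := exists_continuous_inverse hqc hqm hqtop
    (tendsto_id.congr' (by
      filter_upwards [eventually_le_atBot 0] with b hb
      rw [hqneg b hb, id]))
  have hk0 : k 0 = 0 := by rw [← hqneg 0 le_rfl, hkq, hqneg 0 le_rfl]
  refine ⟨k, ⟨hk0, hkm.strictMonoOn _, hkc.continuousOn, hkt⟩, fun d v hd hv hvM => ?_⟩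
  have hv0 : 0 ≤ v := by rw [← hk0]; exact (hkm.monotone hd).trans hv.le
  have h1 : d < q v := by rw [← hqk d]; exact hqm hv
  rw [hqpos v hv0] at h1
  exact h1.le.trans (mul_le_of_le_one_right (hg.nonneg v) ((div_le_one hM).2 hvM))

end IsDecayRate

/-- A quantity that is bounded below by a positive constant on every superlevel set `{W ≥ v}` with
`v > 0` dominates a decay rate in `W`. -/
lemma exists_isDecayRate {X : Type*} {S : Set X} {W φ : X → ℝ} (x₀ : X) (hx₀ : x₀ ∈ S)
    (hW₀ : W x₀ = 0) (hφ₀ : φ x₀ = 0) (hφ : ∀ x ∈ S, 0 ≤ φ x)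
    (h : ∀ v, 0 < v → ∃ a, 0 < a ∧ ∀ x ∈ S, v ≤ W x → a ≤ φ x) :
    ∃ g, IsDecayRate g ∧ ∀ x ∈ S, g (W x) ≤ φ x := by
  have : Nonempty S := ⟨⟨x₀, hx₀⟩⟩
  -- The infimum of `φ` over `{W ≥ v}` may jump in `v`; replacing the constraint by the penalty `max
  -- (v - W x) 0` makes the infimum 1-Lipschitz.
  let F : ℝ → S → ℝ := fun v x => φ x + max (v - W x) 0
  have hF : ∀ v x, 0 ≤ F v x := fun v x => add_nonneg (hφ x x.2) (le_max_right _ _)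
  have hbdd : ∀ v, BddBelow (range (F v)) := fun v => ⟨0, by rintro _ ⟨x, rfl⟩; exact hF v x⟩
  let g : ℝ → ℝ := fun v => ⨅ x, F v x
  have hmono : Monotone g := fun u v huv => ciInf_mono (hbdd u) fun x =>
    add_le_add_right (max_le_max_right _ (sub_le_sub_right huv _)) _
  have hlip : ∀ u v, u ≤ v → g v ≤ g u + (v - u) := by
    intro u v huv
    rw [← sub_le_iff_le_add]
    refine le_ciInf fun x => ?_
    rw [sub_le_iff_le_add]
    refine (ciInf_le (hbdd v) x).trans ?_
    have : max (v - W x) 0 ≤ max (u - W x) 0 + (v - u) :=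
      max_le (by linarith [le_max_left (u - W x) 0]) (by linarith [le_max_right (u - W x) 0])
    change φ x + max (v - W x) 0 ≤ φ x + max (u - W x) 0 + (v - u)
    linarith
  refine ⟨g, ⟨?_, hmono, ?_, ?_⟩, ?_⟩
  · refine (LipschitzWith.of_le_add fun u v => ?_).continuous
    rcases le_total u v with huv | huv
    · exact (hmono huv).trans (le_add_of_nonneg_right dist_nonneg)
    · rw [Real.dist_eq, abs_of_nonneg (sub_nonneg.2 huv)]
      exact hlip v u huv
  · intro v hv
    refine le_antisymm ((ciInf_le (hbdd v) ⟨x₀, hx₀⟩).trans ?_) (le_ciInf (hF v))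
    change φ x₀ + max (v - W x₀) 0 ≤ 0
    rw [hφ₀, hW₀, sub_zero, max_eq_right hv, add_zero]
  · intro v hv
    -- Points with `W x ≥ v / 2` contribute at least `a`; the others pay a penalty of at least `v /
    -- 2`.
    obtain ⟨a, ha, hav⟩ := h (v / 2) (half_pos hv)
    refine lt_of_lt_of_le (lt_min ha (half_pos hv)) (le_ciInf fun x => ?_)
    change _ ≤ φ x + max (v - W x) 0
    rcases le_total (v / 2) (W x) with hx | hx
    · exact (min_le_left _ _).trans ((hav x x.2 hx).trans
        (le_add_of_nonneg_right (le_max_right _ _)))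
    · refine (min_le_right _ _).trans ?_
      have := hφ x x.2
      have := le_max_left (v - W x) 0
      linarith
  · intro x hx
    refine (ciInf_le (hbdd _) ⟨x, hx⟩).trans ?_
    change φ x + max (W x - W x) 0 ≤ φ x
    rw [sub_self, max_self, add_zero]

/-! ### Scalar comparison in integrated form. -/

/-- Comparison principle: a quantity `v` with input `w ≤ d` and dissipation `p ≥ g v`, which
dominates the input while `v > m`, is at most `m` or has decayed at rate `(1 - κ) g`. -/
lemma le_or_decay {g v w p : ℝ → ℝ} {T d m κ : ℝ} (hgm : Monotone g) (hg0 : ∀ r, 0 ≤ g r)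
    (hκ : κ < 1) (hv : ContinuousOn v (Icc 0 T))
    (hw : IntervalIntegrable w volume 0 T) (hp : IntervalIntegrable p volume 0 T)
    (heq : ∀ t ∈ Icc 0 T, v t = v 0 + ∫ s in (0 : ℝ)..t, (w s - p s))
    (hwd : ∀ᵐ s ∂volume.restrict (Ici (0 : ℝ)), w s ≤ d)
    (hpg : ∀ s ∈ Icc 0 T, g (v s) ≤ p s) (hpm : ∀ s ∈ Icc 0 T, m < v s → d ≤ κ * p s)
    {t : ℝ} (ht : t ∈ Icc 0 T) : v t ≤ m ∨ v t + t * ((1 - κ) * g (v t)) ≤ v 0 := by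
  rw [or_iff_not_imp_left, not_le]
  intro hmt
  have hT : (0 : ℝ) ≤ T := ht.1.trans ht.2
  have hsub : ∀ {s r}, 0 ≤ s → s ≤ r → r ≤ T → uIcc s r ⊆ uIcc 0 T := fun h0 h1 h2 => by
    rw [uIcc_of_le h1, uIcc_of_le hT]; exact Icc_subset_Icc h0 h2
  have hint : ∀ {s r}, 0 ≤ s → s ≤ r → r ≤ T →
      IntervalIntegrable (fun u => w u - p u) volume s r := fun h0 h1 h2 =>
    (hw.sub hp).mono_set (hsub h0 h1 h2)
  have hdiff : ∀ {s r}, 0 ≤ s → s ≤ r → r ≤ T → v r - v s = ∫ u in s..r, (w u - p u) := by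
    intro s r h0 h1 h2
    rw [heq r ⟨h0.trans h1, h2⟩, heq s ⟨h0, h1.trans h2⟩,
      ← intervalIntegral.integral_add_adjacent_intervals (hint le_rfl h0 (h1.trans h2))
        (hint h0 h1 h2)]
    ring
  have hbound : ∀ {s r γ}, 0 ≤ s → s ≤ r → r ≤ T → (∀ u ∈ Ioc s r, m < v u) →
      (∀ u ∈ Ioc s r, γ ≤ (1 - κ) * p u) → v r - v s ≤ -((r - s) * γ) := by
    intro s r γ h0 h1 h2 hmu hγ
    rw [hdiff h0 h1 h2]
    have hconst : -((r - s) * γ) = ∫ _ in s..r, -γ := by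
      rw [intervalIntegral.integral_const, smul_eq_mul, mul_neg]
    rw [hconst, intervalIntegral.integral_of_le h1, intervalIntegral.integral_of_le h1]
    refine setIntegral_mono_on_ae (hint h0 h1 h2).1 (intervalIntegrable_const (a := s) (b := r)).1
      measurableSet_Ioc ?_
    filter_upwards [(ae_restrict_iff' measurableSet_Ici).1 hwd] with u hu hus
    have hu1 := hu (h0.trans hus.1.le)
    have hu2 := hpm u ⟨h0.trans hus.1.le, hus.2.trans h2⟩ (hmu u hus)
    have hu3 := hγ u hus
    linarith
  have hp0 : ∀ u ∈ Icc 0 T, 0 ≤ (1 - κ) * p u := fun u hu =>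
    mul_nonneg (sub_nonneg.2 hκ.le) ((hg0 _).trans (hpg u hu))
  have habove : ∀ s ∈ Icc 0 t, m < v s := by
    by_contra! hcon
    obtain ⟨s, hs, hsm⟩ := hcon
    -- After the last time `r` with `v r ≤ m`, the dissipation dominates the input, so `v t ≤ v r ≤
    -- m`, a contradiction.
    let A : Set ℝ := Icc 0 t ∩ v ⁻¹' Iic m
    have hA : IsClosed A :=
      (hv.mono (Icc_subset_Icc_right ht.2)).preimage_isClosed_of_isClosed isClosed_Icc isClosed_Iic
    have hAne : A.Nonempty := ⟨s, hs, hsm⟩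
    have hAb : BddAbove A := ⟨t, fun u hu => hu.1.2⟩
    have hmem := hA.csSup_mem hAne hAb
    set r := sSup A with hr
    have := hbound (s := r) (r := t) (γ := 0) hmem.1.1 hmem.1.2 ht.2 (fun u hu => by
        by_contra! hle
        exact absurd (le_csSup hAb ⟨⟨hmem.1.1.trans hu.1.le, hu.2⟩, hle⟩) (not_le.2 hu.1))
      (fun u hu => hp0 u ⟨hmem.1.1.trans hu.1.le, hu.2.trans ht.2⟩)
    have h2 : v r ≤ m := hmem.2
    linarith
  -- Since `v` never drops below its final value on `[0, t]`, the rate `(1 - κ) * g (v t)` is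
  -- available throughout; no differential equation has to be solved.
  have hdecr : ∀ u ∈ Icc 0 t, v t ≤ v u := by
    intro u hu
    have := hbound (s := u) (r := t) (γ := 0) hu.1 hu.2 ht.2
      (fun z hz => habove z ⟨hu.1.trans hz.1.le, hz.2⟩)
      (fun z hz => hp0 z ⟨hu.1.trans hz.1.le, hz.2.trans ht.2⟩)
    linarith
  have := hbound (s := 0) (r := t) (γ := (1 - κ) * g (v t)) le_rfl ht.1 ht.2
    (fun z hz => habove z ⟨hz.1.le, hz.2⟩)
    (fun z hz => mul_le_mul_of_nonneg_left
      ((hgm (hdecr z ⟨hz.1.le, hz.2⟩)).trans (hpg z ⟨hz.1.le, hz.2.trans ht.2⟩))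
      (sub_nonneg.2 hκ.le))
  linarith

/-! ### Essential suprema, levels at infinity and the rate of the total outflow. -/

/-- If the essential supremum over `t ≥ 0` of a non-negative function is at most the real `U`, then
it is a real number in `[0, U]` that bounds the function almost everywhere. -/
lemma essSupTime_toReal_spec {h : ℝ → ℝ} {U : ℝ} (h0 : ∀ t, 0 ≤ t → 0 ≤ h t)
    (hU : essSupTime h ≤ U) :
    0 ≤ (essSupTime h).toReal ∧ (essSupTime h).toReal ≤ U ∧
      ∀ᵐ t ∂volume.restrict (Ici (0 : ℝ)), h t ≤ (essSupTime h).toReal := by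
  have hae : ∀ᵐ t ∂volume.restrict (Ici (0 : ℝ)), (h t : EReal) ≤ essSupTime h := ae_le_essSup
  have hne : NeBot (ae (volume.restrict (Ici (0 : ℝ)))) := by
    rw [ae_neBot, Ne, Measure.restrict_eq_zero, Real.volume_Ici]
    exact ENNReal.top_ne_zero
  have hnonneg : 0 ≤ essSupTime h := by
    obtain ⟨t, ht, ht0⟩ := (hae.and (ae_restrict_mem measurableSet_Ici)).exists
    exact le_trans (EReal.coe_nonneg.2 (h0 t ht0)) ht
  have hcoe : ((essSupTime h).toReal : EReal) = essSupTime h :=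
    EReal.coe_toReal (ne_top_of_le_ne_top (EReal.coe_ne_top U) hU)
      (ne_bot_of_le_ne_bot EReal.zero_ne_bot hnonneg)
  refine ⟨EReal.toReal_nonneg hnonneg, ?_, ?_⟩
  · rwa [← EReal.coe_le_coe_iff, hcoe]
  · filter_upwards [hae] with t ht
    rwa [← EReal.coe_le_coe_iff, hcoe]

lemma IsFlowFunction.sum_zero {E : Type*} [Fintype E] {f : (E → ℝ) → E → ℝ}
    (hf : IsFlowFunction f) (c : E → ℝ) : ∑ i, normalizedFlow f c 0 i = 0 :=
  Finset.sum_eq_zero fun i _ => by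
    rw [normalizedFlow, (hf.eq_zero_iff 0 (fun _ => le_rfl) i).2 rfl, zero_div]

lemma continuous_dotProduct_left {E : Type*} [Fintype E] (p : E → ℝ) :
    Continuous fun x : E → ℝ => p ⬝ᵥ x :=
  continuous_finsetSum _ fun i _ => continuous_const.mul (continuous_apply i)

lemma isClosed_stateSpace (E : Type*) : IsClosed (stateSpace E) := by
  have : stateSpace E = ⋂ i, {x : E → ℝ | 0 ≤ x i} := by
    ext x; simp [stateSpace]
  rw [this]
  exact isClosed_iInter fun i => isClosed_le continuous_const (continuous_apply i)

/-- A lower bound of a lower limit at infinity holds on a superlevel set of every non-negative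
linear functional. -/
lemma exists_level_of_lt_liminf {E : Type*} [Fintype E] {φ : (E → ℝ) → ℝ} {U : ℝ}
    (hU : (U : EReal) < liminf (fun x => (φ x : EReal)) (toInfinity E)) {p : E → ℝ}
    (hp : ∀ i, 0 ≤ p i) :
    ∃ L, U < L ∧ ∃ M, 0 < M ∧ ∀ x ∈ stateSpace E, M ≤ p ⬝ᵥ x → L ≤ φ x := by
  obtain ⟨L, hUL, hL⟩ := EReal.lt_iff_exists_real_btwn.1 hU
  refine ⟨L, EReal.coe_lt_coe_iff.1 hUL, ?_⟩
  have hev := eventually_lt_of_lt_liminf hL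
  rw [toInfinity, eventually_inf_principal, eventually_comap, eventually_atTop] at hev
  obtain ⟨B, hB⟩ := hev
  refine ⟨max 1 ((∑ i, p i) * B + 1), by positivity, fun x hx hM => ?_⟩
  have hxB : B ≤ ∑ i, |x i| := by
    by_contra! hlt
    have h1 : p ⬝ᵥ x ≤ (∑ i, p i) * ∑ i, |x i| := by
      rw [Finset.sum_mul]
      refine Finset.sum_le_sum fun i _ => mul_le_mul_of_nonneg_left ?_ (hp i)
      exact (le_abs_self _).trans
        (Finset.single_le_sum (f := fun i => |x i|) (fun j _ => abs_nonneg _) (Finset.mem_univ i))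
    have h2 := mul_le_mul_of_nonneg_left hlt.le (Fintype.sum_nonneg hp)
    have h3 := le_max_right 1 ((∑ i, p i) * B + 1)
    linarith
  exact (EReal.coe_lt_coe_iff.1 (hB _ hxB x rfl hx)).le

/-- The total normalized outflow dominates a decay rate in the transformed norm. -/
lemma IsFlowFunction.exists_isDecayRate {V E : Type*} [Fintype E] [DecidableEq E]
    {N : FlowNetwork V E} (hN : N.OutflowConnected) {f : (E → ℝ) → E → ℝ} (hf : IsFlowFunction f)
    {c : E → ℝ} (hc : ∀ i, 0 < c i) {L M : ℝ} (hL : 0 < L)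
    (hM : ∀ x ∈ stateSpace E, M ≤ N.potential c ⬝ᵥ x → L ≤ ∑ i, normalizedFlow f c x i) :
    ∃ g, IsDecayRate g ∧
      ∀ x ∈ stateSpace E, g (N.potential c ⬝ᵥ x) ≤ ∑ i, normalizedFlow f c x i := by
  refine _root_.exists_isDecayRate (S := stateSpace E) (W := fun x => N.potential c ⬝ᵥ x) 0
    (fun _ => le_rfl) (dotProduct_zero _) (hf.sum_zero c) (fun x hx => hf.sum_nonneg hc hx) ?_
  intro v hv
  -- Only the slice `v ≤ W ≤ M` needs compactness; above `M` the bound `L` holds.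
  let A : Set (E → ℝ) :=
    stateSpace E ∩ {x | v ≤ N.potential c ⬝ᵥ x} ∩ {x | N.potential c ⬝ᵥ x ≤ M}
  have hcont := continuous_dotProduct_left (N.potential c)
  have hAclosed : IsClosed A := ((isClosed_stateSpace E).inter
    (isClosed_le continuous_const hcont)).inter (isClosed_le hcont continuous_const)
  have hAcompact : IsCompact A := by
    refine (isCompact_univ_pi fun i => isCompact_Icc (a := 0) (b := M * c i)).of_isClosed_subset
      hAclosed fun x hx i _ => ⟨hx.1.1 i, ?_⟩
    exact (div_le_iff₀ (hc i)).1 ((hN.div_le_potential_dotProduct hc hx.1.1 i).trans hx.2)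
  rcases A.eq_empty_or_nonempty with hA | hA
  · refine ⟨L, hL, fun x hx hvx => hM x hx (le_of_not_ge fun hxM => ?_)⟩
    exact (hA ▸ (⟨⟨hx, hvx⟩, hxM⟩ : x ∈ A) : x ∈ (∅ : Set (E → ℝ)))
  · obtain ⟨y, hy, hmin⟩ := hAcompact.exists_isMinOn hA
      ((hf.continuousOn_sum c).mono fun x hx => hx.1.1)
    have hy0 : y ≠ 0 := by
      rintro rfl
      have h : v ≤ N.potential c ⬝ᵥ (0 : E → ℝ) := hy.1.2
      rw [dotProduct_zero] at h
      exact absurd hv (not_lt.2 h)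
    refine ⟨min L (∑ i, normalizedFlow f c y i), lt_min hL (hf.sum_pos hc hy.1.1 hy0),
      fun x hx hvx => ?_⟩
    rcases le_total M (N.potential c ⬝ᵥ x) with hxM | hxM
    · exact (min_le_left _ _).trans (hM x hx hxM)
    · exact (min_le_right _ _).trans (hmin ⟨⟨hx, hvx⟩, hxM⟩)

/-! ### Balance along solutions and the main theorem. -/

/-- The balance equation of the transformed norm along a solution. -/
lemma FlowNetwork.IsSolution.potential_balance {V E : Type*} [Fintype E] [DecidableEq E]
    {N : FlowNetwork V E} (hN : N.OutflowConnected) {f : (E → ℝ) → E → ℝ} (hf : IsFlowFunction f)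
    {c : E → ℝ} (hc : ∀ i, 0 < c i) {lam : ℝ → E → ℝ} (hlam : IsInflow lam) {T : ℝ}
    {x : ℝ → E → ℝ} (hx : N.IsSolution c (normalizedFlow f c) lam T x) {t : ℝ}
    (ht : t ∈ Icc 0 T) :
    N.potential c ⬝ᵥ x t = N.potential c ⬝ᵥ x 0 +
      ∫ s in (0 : ℝ)..t, (N.potential c ⬝ᵥ lam s - ∑ i, normalizedFlow f c (x s) i) := by
  let B := (1 - N.Rᵀ) * Matrix.diagonal c
  have hflow : ∀ j, ContinuousOn (fun s => normalizedFlow f c (x s) j) (Icc 0 T) := fun j => by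
    obtain ⟨K, hK⟩ := hf.lipschitz j
    exact (hK.continuousOn.comp hx.continuousOn hx.mem).div_const _
  have hint : ∀ i ∈ Finset.univ, IntervalIntegrable (fun s => N.potential c i *
      (lam s i - (B *ᵥ normalizedFlow f c (x s)) i)) volume 0 t := fun i _ => by
    refine ((hlam.integrable t ht.1 i).sub (ContinuousOn.intervalIntegrable ?_)).const_mul _
    rw [uIcc_of_le ht.1]
    exact continuousOn_finsetSum _ fun j _ => continuousOn_const.mul
      ((hflow j).mono (Icc_subset_Icc_right ht.2))
  have hpt : ∀ s, N.potential c ⬝ᵥ lam s - ∑ i, normalizedFlow f c (x s) i =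
      ∑ i, N.potential c i * (lam s i - (B *ᵥ normalizedFlow f c (x s)) i) := fun s => by
    rw [← hN.potential_dotProduct_outflow hc (normalizedFlow f c (x s)), ← dotProduct_sub]
    rfl
  simp_rw [hpt]
  rw [intervalIntegral.integral_finsetSum hint]
  simp only [intervalIntegral.integral_const_mul, dotProduct]
  rw [← Finset.sum_add_distrib]
  refine Finset.sum_congr rfl fun i _ => ?_
  rw [hx.integral_eq t ht i, mul_add]

theorem theorem2 {V E : Type*} [Fintype E] [DecidableEq E] (N : FlowNetwork V E)
    (hN : N.OutflowConnected) (f : (E → ℝ) → E → ℝ) (hf : IsFlowFunction f)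
    (c : E → ℝ) (hc : IsCapacity f c)
    (U : ℝ) (hU : (U : EReal) <
      liminf (fun x => ((∑ i, normalizedFlow f c x i : ℝ) : EReal)) (toInfinity E)) :
    ∃ beta : ℝ → ℝ → ℝ, IsKL beta ∧ ∃ mu : ℝ → ℝ, IsKInfty mu ∧
      ∀ lam : ℝ → E → ℝ, IsInflow lam →
        essSupTime (fun t => ∑ i, N.transform (lam t) i / c i) ≤ U →
        ∀ (T : ℝ) (x : ℝ → E → ℝ), N.IsSolution c (normalizedFlow f c) lam T x →
          ∀ t ∈ Icc 0 T,
            weightedNorm (fun i => 1 / c i) (N.transform (x t)) ≤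
              beta (weightedNorm (fun i => 1 / c i) (N.transform (x 0))) t +
              mu (essSupTime
                (fun s => weightedNorm (fun i => 1 / c i) (N.transform (lam s)))).toReal := by
  have hcpos := hc.pos hf
  have hp := hN.potential_nonneg hcpos
  have hp_dot : ∀ {z : E → ℝ}, z ∈ stateSpace E → 0 ≤ N.potential c ⬝ᵥ z := fun hz =>
    Finset.sum_nonneg fun i _ => mul_nonneg (hp i) (hz i)
  have hspec : ∀ lam : ℝ → E → ℝ, IsInflow lam →
      essSupTime (fun t => ∑ i, N.transform (lam t) i / c i) ≤ U →
      ∃ d, (essSupTime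
          (fun s => weightedNorm (fun i => 1 / c i) (N.transform (lam s)))).toReal = d ∧
        0 ≤ d ∧ d ≤ U ∧ ∀ᵐ t ∂volume.restrict (Ici (0 : ℝ)), N.potential c ⬝ᵥ lam t ≤ d := by
    intro lam hlam hle
    have h1 : essSupTime (fun s => weightedNorm (fun i => 1 / c i) (N.transform (lam s))) =
        essSupTime (fun s => N.potential c ⬝ᵥ lam s) := by
      refine essSup_congr_ae ?_
      filter_upwards [ae_restrict_mem measurableSet_Ici] with t ht
      rw [hN.weightedNorm_transform c (hlam.nonneg t ht)]
    simp_rw [← N.potential_dotProduct c] at hle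
    obtain ⟨h2, h3, h4⟩ := essSupTime_toReal_spec (fun t ht => hp_dot (hlam.nonneg t ht)) hle
    exact ⟨_, by rw [h1], h2, h3, h4⟩
  obtain ⟨L, hUL, M, hM, hLM⟩ := exists_level_of_lt_liminf hU hp
  -- For `U < 0` no inflow is admissible, so any comparison functions will do.
  rcases lt_or_ge U 0 with hneg | hU0
  · have hid : IsDecayRate fun v => max v 0 :=
      ⟨continuous_id.max continuous_const, fun u v huv => max_le_max_right 0 huv,
        fun v hv => max_eq_right hv, fun v hv => lt_max_of_lt_left hv⟩
    obtain ⟨beta, hbeta, -⟩ := hid.exists_isKL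
    obtain ⟨mu, hmu, -⟩ := hid.exists_isKInfty one_pos
    refine ⟨beta, hbeta, mu, hmu, fun lam hlam hle => ?_⟩
    obtain ⟨d, -, hd0, hdU, -⟩ := hspec lam hlam hle
    exact absurd (hd0.trans hdU) (not_le.2 hneg)
  -- Using `U'` rather than `U` keeps `κ` positive even for `U = 0`, as the construction of `mu`
  -- requires.
  obtain ⟨U', hUU', hU'L⟩ := exists_between hUL
  have hU' : 0 < U' := hU0.trans_lt hUU'
  have hL : 0 < L := hU'.trans hU'L
  set κ := U' / L with hκdef
  have hκ0 : 0 < κ := div_pos hU' hL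
  have hκ1 : κ < 1 := (div_lt_one hL).2 hU'L
  have hκL : κ * L = U' := div_mul_cancel₀ _ hL.ne'
  obtain ⟨g, hg, hgφ⟩ := hf.exists_isDecayRate hN hcpos hL hLM
  obtain ⟨beta, hbeta, hbeta_le⟩ := (hg.const_mul (sub_pos.2 hκ1)).exists_isKL
  obtain ⟨mu, hmu, hmu_le⟩ := (hg.const_mul hκ0).exists_isKInfty hM
  refine ⟨beta, hbeta, mu, hmu, fun lam hlam hle T x hx t ht => ?_⟩
  obtain ⟨d, hd, hd0, hdU, hdae⟩ := hspec lam hlam hle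
  have hT : (0 : ℝ) ≤ T := ht.1.trans ht.2
  have hx0 : x 0 ∈ stateSpace E := hx.mem 0 ⟨le_rfl, hT⟩
  rw [hd, hN.weightedNorm_transform c (hx.mem t ht), hN.weightedNorm_transform c hx0]
  have hmu0 : 0 ≤ mu d := by
    rw [← hmu.zero]; exact hmu.strictMonoOn.monotoneOn self_mem_Ici hd0 hd0
  have hbeta0 : 0 ≤ beta (N.potential c ⬝ᵥ x 0) t := by
    refine (hbeta.zero t ht.1).symm.trans_le ?_
    exact (hbeta.strictMonoOn t ht.1).monotoneOn self_mem_Ici (hp_dot hx0) (hp_dot hx0)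
  have hlamint : IntervalIntegrable (fun s => N.potential c ⬝ᵥ lam s) volume 0 T := by
    have := IntervalIntegrable.sum Finset.univ (f := fun i s => N.potential c i * lam s i)
      fun i _ => (hlam.integrable T hT i).const_mul (N.potential c i)
    refine this.congr fun s _ => ?_
    rw [Finset.sum_apply]
    rfl
  have hφint : IntervalIntegrable (fun s => ∑ i, normalizedFlow f c (x s) i) volume 0 T := by
    refine ContinuousOn.intervalIntegrable ?_
    rw [uIcc_of_le hT]
    exact (hf.continuousOn_sum c).comp hx.continuousOn hx.mem
  have hdom : ∀ s ∈ Icc 0 T, mu d < N.potential c ⬝ᵥ x s →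
      d ≤ κ * ∑ i, normalizedFlow f c (x s) i := fun s hs hms => by
    rcases le_total (N.potential c ⬝ᵥ x s) M with hsM | hsM
    · exact (hmu_le d _ hd0 hms hsM).trans
        (mul_le_mul_of_nonneg_left (hgφ _ (hx.mem s hs)) hκ0.le)
    · refine (hdU.trans hUU'.le).trans ?_
      rw [← hκL]
      exact mul_le_mul_of_nonneg_left (hLM _ (hx.mem s hs) hsM) hκ0.le
  rcases le_or_decay (v := fun s => N.potential c ⬝ᵥ x s) (m := mu d) hg.monotone
    hg.nonneg hκ1 ((continuous_dotProduct_left _).comp_continuousOn hx.continuousOn) hlamint hφint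
    (fun s hs => hx.potential_balance hN hf hcpos hlam hs) hdae
    (fun s hs => hgφ _ (hx.mem s hs)) hdom ht with h | h
  · exact h.trans (le_add_of_nonneg_left hbeta0)
  · exact (hbeta_le t ht.1 _ _ h).trans (le_add_of_nonneg_right hmu0)
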